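/- Let $q$ be a prime power, $n\ge 1$, and equip $\mathbb F_q^n$ with the standard inner product. For a subspace $C\le\mathbb F_q^n$ let $C^\perp$ be its orthogonal; $C$ is self-orthogonal if $C\subseteq C^\perp$. Let $\Sigma_q(n,k)$ be the set of $k$-dimensional self-orthogonal subspaces of $\mathbb F_q^n$ (for $n\ge 0$), $\sigma_q(n,k)=|\Sigma_q(n,k)|$, and let $w$ be the Witt index of $\mathbb F_q^n$, i.e. the maximal dimension of a self-orthogonal subspace. The type of $(q,n)$ is - (P) if $q$ and $n$ are odd; - (H) if $q$ is odd, $n$ is even and $w=n/2$; - (E) if $q$ is odd, $n$ is even and $w=n/2-1$; - (N$_1$) if $q$ is even and $n$ is odd; - (N$_{0,\mathrm{na}}$) if $q$ and $n$ are even (the standard inner product is then not alternating). These are all the cases. For $0\le k\le w'\le n'/2$ put $$\tau_q(n',k,w')=\prod_{i=1}^{k}\frac{(q^{n'-w'-i}+1)(q^{w'-i+1}-1)}{q^i-1},$$ so that $\tau_q(n',0,w')=1$. **Proposition.** Let $0\le t\le k\le w$, let $U\le\mathbb F_q^n$ be a $t$-dimensional self-orthogonal subspace, and let $\mathbf 1\in\mathbb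 F_q^n$ be the all-one vector. Then $$\big|\{C\in\Sigma_q(n,k)\mid U\le C\}\big|=\begin{cases}\tau_q(n-2t,k-t,w-t)&\text{if the type of }(q,n)\text{ is (P), (H), (E) or (N}_1),\\ \sigma_q(n-2t,k-t)&\text{if the type of }(q,n)\text{ is (N}_{0,\mathrm{na}})\text{ and }\mathbf 1\notin U,\\ \sigma_q(n-2t+1,k-t)&\text{if the type of }(q,n)\text{ is (N}_{0,\mathrm{na}})\text{ and }\mathbf 1\in U.\end{cases}$$ -/

import Mathlib

noncomputable section

namespace BilinearCodes

section General

variable {F V : Type*} [Field F] [AddCommGroup V] [Module F V]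

/-- `C` is self-orthogonal with respect to `B`: it is contained in its orthogonal. -/
def IsSelfOrthogonal (B : LinearMap.BilinForm F V) (C : Submodule F V) : Prop :=
  C ≤ B.orthogonal C

/-- `C` is `l`-complementary: its radical, the intersection of `C` with its orthogonal,
has dimension `l`. -/
def IsComplementary (B : LinearMap.BilinForm F V) (l : ℕ) (C : Submodule F V) : Prop :=
  Module.finrank F (C ⊓ B.orthogonal C : Submodule F V) = l

/-- The set of `k`-dimensional `l`-complementary subspaces of `(V, B)`. -/
def complementarySubspaces (B : LinearMap.BilinForm F V) (k l : ℕ) : Set (Submodule F V) :=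
  {C | Module.finrank F C = k ∧ IsComplementary B l C}

/-- The Witt index of `(V, B)`: the maximal dimension of a self-orthogonal subspace.
(For finite-dimensional `V` this is the supremum of a bounded set of natural numbers
that contains `0`.) -/
def wittIndex (B : LinearMap.BilinForm F V) : ℕ :=
  sSup {d | ∃ C : Submodule F V, IsSelfOrthogonal B C ∧ Module.finrank F C = d}

/-- The names of the types of bilinear spaces: parabolic, hyperbolic and elliptic for odd `q`;
`N1`, `N0a` (alternating) and `N0na` (non-alternating) for even `q`. -/
inductive BilinType where
  | P
  | H
  | E
  | N1
  | N0a
  | N0na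

open Classical in
/-- The type of a finite bilinear space `(V, B)` (with `B` symmetric and non-degenerate) of
dimension `n` over a field with `q` elements.
For `q` odd and `n` even, the Witt index of such a space is `n / 2` or `n / 2 - 1`;
type `H` is the former case and type `E` the latter. -/
def bilinType [Fintype F] (B : LinearMap.BilinForm F V) : BilinType :=
  if Odd (Fintype.card F) then
    if Odd (Module.finrank F V) then BilinType.P
    else if wittIndex B = Module.finrank F V / 2 then BilinType.H
    else BilinType.E
  else
    if Odd (Module.finrank F V) then BilinType.N1
    else if B.IsAlt then BilinType.N0a
    else BilinType.N0na

end General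

/-- The standard inner product (dot product) on `F ^ n`. -/
def stdForm (F : Type*) [Field F] (n : ℕ) : LinearMap.BilinForm F (Fin n → F) :=
  dotProductBilin F F

/-- The set of self-orthogonal `k`-dimensional codes in `F ^ n`, i.e. of the `k`-dimensional
`k`-complementary subspaces with respect to the dot product. -/
def selfOrthogonalCodes (F : Type*) [Field F] (n k : ℕ) : Set (Submodule F (Fin n → F)) :=
  complementarySubspaces (stdForm F n) k k

/-- The number of self-orthogonal `k`-dimensional codes in `F ^ n`. -/
def numSelfOrthogonalCodes (F : Type*) [Field F] (n k : ℕ) : ℕ :=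
  (selfOrthogonalCodes F n k).ncard

/-- `∏_{i=1}^{k} (q^{n-w-i} + 1) (q^{w-i+1} - 1) / (q^i - 1)`, for `k ≤ w ≤ n / 2`
(in this range no subtraction in the exponents is truncated); it is `1` for `k = 0`. -/
def tau (q n k w : ℕ) : ℚ :=
  ∏ i ∈ Finset.Icc 1 k,
    (((q : ℚ) ^ (n - w - i) + 1) * ((q : ℚ) ^ (w + 1 - i) - 1)) / ((q : ℚ) ^ i - 1)

end BilinearCodes

end

/-! Write t = dim U, and let N(U,k) count the k-dimensional self-orthogonal spaces above U. Double
counting pairs (v, C) with v ∈ C \ U gives N(U,k)(q^k - q^t) = Σ N(U + ⟨v⟩, k), the sum running over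
isotropic v ∈ U^⊥ \ U (`ncard_selfOrthogonalAbove_mul`). Hence N is determined recursively once the
number I(U) of isotropic vectors in U^⊥ is known.

For q odd, I(U) - q^(n-t-1) does not change when U grows by an isotropic vector. Comparison with a
maximal W, for which I(W) = q^w, gives I(U) = q^w + q^(n-t-1) - q^(n-w-1), and the recursion becomes
that of τ.

For q even, B(v,v) is the square of B(e,v) with e = 𝟏, so the isotropic vectors of U^⊥ form (U +
⟨e⟩)^⊥. If n is odd, e is not isotropic and so never lies in U; then n = 2w + 1 and I(U) has the
same form as for q odd. If n is even, the recursion depends on whether e ∈ U. When e ∉ U, it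
involves only n - 2t, and the trivial subspace of F^(n-2t) satisfies the same one. When e ∈ U, it is
the symplectic recursion in dimension n - 2t, which also governs the odd-dimensional space
F^(n-2t+1). -/

namespace BilinearCodes

/-! ### Self-orthogonal subspaces, the Witt index and the double count -/

section Counting

open Module

variable {F V : Type*} [Field F] [AddCommGroup V] [Module F V]

/-- The isotropic vectors in the orthogonal of `U`. -/
def isotropicOrthogonal (B : LinearMap.BilinForm F V) (U : Submodule F V) : Set V :=
  {v | v ∈ B.orthogonal U ∧ B v v = 0}

/-- The self-orthogonal `k`-dimensional subspaces containing `U`. -/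
def selfOrthogonalAbove (B : LinearMap.BilinForm F V) (U : Submodule F V) (k : ℕ) :
    Set (Submodule F V) :=
  {C | U ≤ C ∧ IsSelfOrthogonal B C ∧ finrank F C = k}

theorem IsSelfOrthogonal.apply_eq_zero {B : LinearMap.BilinForm F V} {C : Submodule F V}
    (h : IsSelfOrthogonal B C) {x y : V} (hx : x ∈ C) (hy : y ∈ C) : B x y = 0 :=
  h hy x hx

theorem IsSelfOrthogonal.mono {B : LinearMap.BilinForm F V} {C D : Submodule F V}
    (h : IsSelfOrthogonal B D) (hCD : C ≤ D) : IsSelfOrthogonal B C :=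
  fun _ hy _ hx => h.apply_eq_zero (hCD hx) (hCD hy)

theorem IsSelfOrthogonal.subset_isotropicOrthogonal {B : LinearMap.BilinForm F V}
    {C D : Submodule F V} (h : IsSelfOrthogonal B D) (hCD : C ≤ D) :
    (D : Set V) ⊆ isotropicOrthogonal B C :=
  fun _ hy => ⟨fun _ hx => h.apply_eq_zero (hCD hx) hy, h.apply_eq_zero hy hy⟩

theorem isSelfOrthogonal_bot (B : LinearMap.BilinForm F V) : IsSelfOrthogonal B ⊥ :=
  bot_le

theorem sup_span_singleton_le {U C : Submodule F V} {v : V} :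
    U ⊔ Submodule.span F {v} ≤ C ↔ U ≤ C ∧ v ∈ C := by
  rw [sup_le_iff, Submodule.span_singleton_le_iff_mem]

theorem IsSelfOrthogonal.sup_span_singleton {B : LinearMap.BilinForm F V} (hs : B.IsSymm)
    {U : Submodule F V} (h : IsSelfOrthogonal B U) {v : V} (hv : v ∈ isotropicOrthogonal B U) :
    IsSelfOrthogonal B (U ⊔ Submodule.span F {v}) := by
  intro y hy x hx
  obtain ⟨y', hy', b, hb, rfl⟩ := Submodule.mem_sup.1 hy
  obtain ⟨x', hx', a, ha, rfl⟩ := Submodule.mem_sup.1 hx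
  obtain ⟨b, rfl⟩ := Submodule.mem_span_singleton.1 hb
  obtain ⟨a, rfl⟩ := Submodule.mem_span_singleton.1 ha
  have h1 : B x' v = 0 := hv.1 x' hx'
  have h2 : B v y' = 0 := by rw [hs.eq v y']; exact hv.1 y' hy'
  simp [h1, h2, hv.2, h.apply_eq_zero hx' hy']

/-- The hypothesis on `e` makes isotropy a linear condition; it models characteristic 2, where `e`
is the all-one vector. -/
theorem isotropicOrthogonal_eq_orthogonal {B : LinearMap.BilinForm F V} {e : V}
    (he : ∀ v, B v v = 0 ↔ B e v = 0) (U : Submodule F V) :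
    isotropicOrthogonal B U = B.orthogonal (U ⊔ Submodule.span F {e}) := by
  ext x
  simp only [isotropicOrthogonal, Set.mem_ofPred_eq, he, SetLike.mem_coe]
  constructor
  · rintro ⟨h1, h3⟩ y hy
    obtain ⟨y', hy', b, hb, rfl⟩ := Submodule.mem_sup.1 hy
    obtain ⟨b, rfl⟩ := Submodule.mem_span_singleton.1 hb
    have : B y' x = 0 := h1 y' hy'
    simp [this, h3]
  · intro h
    obtain ⟨h1, h2⟩ := sup_span_singleton_le.1 (le_refl (U ⊔ Submodule.span F {e}))
    exact ⟨fun y hy => h y (h1 hy), h e h2⟩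

variable [FiniteDimensional F V]

theorem IsSelfOrthogonal.two_mul_finrank_le {B : LinearMap.BilinForm F V} (hB : B.Nondegenerate)
    {U : Submodule F V} (h : IsSelfOrthogonal B U) : 2 * finrank F U ≤ finrank F V := by
  have h1 := Submodule.finrank_mono h
  rw [LinearMap.BilinForm.finrank_orthogonal hB] at h1
  have h2 := Submodule.finrank_le U
  omega

theorem bddAbove_finrank_isSelfOrthogonal (B : LinearMap.BilinForm F V) :
    BddAbove {d | ∃ C : Submodule F V, IsSelfOrthogonal B C ∧ finrank F C = d} :=
  ⟨finrank F V, by rintro _ ⟨C, -, rfl⟩; exact Submodule.finrank_le C⟩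

theorem IsSelfOrthogonal.finrank_le_wittIndex {B : LinearMap.BilinForm F V} {U : Submodule F V}
    (h : IsSelfOrthogonal B U) : finrank F U ≤ wittIndex B :=
  le_csSup (bddAbove_finrank_isSelfOrthogonal B) ⟨U, h, rfl⟩

theorem exists_finrank_eq_wittIndex (B : LinearMap.BilinForm F V) :
    ∃ C : Submodule F V, IsSelfOrthogonal B C ∧ finrank F C = wittIndex B :=
  Nat.sSup_mem (s := {d | ∃ C : Submodule F V, IsSelfOrthogonal B C ∧ finrank F C = d})
    ⟨0, ⊥, isSelfOrthogonal_bot B, finrank_bot F V⟩ (bddAbove_finrank_isSelfOrthogonal B)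

/-- A self-orthogonal subspace of maximal dimension contains all isotropic vectors that are
orthogonal to it. -/
theorem isotropicOrthogonal_eq_of_finrank_eq_wittIndex {B : LinearMap.BilinForm F V}
    (hs : B.IsSymm) {W : Submodule F V} (hW : IsSelfOrthogonal B W)
    (hdim : finrank F W = wittIndex B) : isotropicOrthogonal B W = W := by
  refine Set.Subset.antisymm (fun v hv => ?_) (hW.subset_isotropicOrthogonal le_rfl)
  by_contra hvW
  have h1 := (hW.sup_span_singleton hs hv).finrank_le_wittIndex
  rw [Submodule.finrank_sup_span_singleton hvW] at h1
  omega

theorem mem_complementarySubspaces_self {B : LinearMap.BilinForm F V} {k : ℕ}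
    {C : Submodule F V} :
    C ∈ complementarySubspaces B k k ↔ IsSelfOrthogonal B C ∧ finrank F C = k := by
  constructor
  · rintro ⟨h1, h2⟩
    refine ⟨?_, h1⟩
    have := Submodule.eq_of_le_of_finrank_eq
      (inf_le_left : C ⊓ B.orthogonal C ≤ C) (h2.trans h1.symm)
    exact inf_eq_left.1 this
  · rintro ⟨h1, h2⟩
    refine ⟨h2, ?_⟩
    rw [IsComplementary, inf_eq_left.2 h1, h2]

theorem selfOrthogonalAbove_self {B : LinearMap.BilinForm F V} {U : Submodule F V}
    (h : IsSelfOrthogonal B U) : selfOrthogonalAbove B U (finrank F U) = {U} := by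
  ext C
  constructor
  · rintro ⟨h1, -, h3⟩
    exact (Submodule.eq_of_le_of_finrank_eq h1 h3.symm).symm
  · rintro rfl
    exact ⟨le_rfl, h, rfl⟩

variable [Fintype F]

theorem ncard_coe_submodule (C : Submodule F V) :
    (C : Set V).ncard = Fintype.card F ^ finrank F C := by
  rw [← Nat.card_coe_set_eq, ← Nat.card_eq_fintype_card (α := F)]
  exact Module.natCard_eq_pow_finrank (K := F) (V := C)

theorem ncard_submodule_diff {U C : Submodule F V} (h : U ≤ C) :
    ((C : Set V) \ U).ncard + Fintype.card F ^ finrank F U = Fintype.card F ^ finrank F C := by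
  have : Finite V := Module.finite_of_finite F
  rw [← ncard_coe_submodule, ← ncard_coe_submodule, Set.ncard_sdiff_add_ncard_of_subset h]

/-- Double counting of the pairs `(v, C)` with `v ∈ C \ U`. -/
theorem ncard_selfOrthogonalAbove_mul (B : LinearMap.BilinForm F V) (U : Submodule F V) (k : ℕ)
    {s : Finset V} (hs : (s : Set V) = isotropicOrthogonal B U \ U) :
    ((selfOrthogonalAbove B U k).ncard : ℚ) *
        ((Fintype.card F : ℚ) ^ k - (Fintype.card F : ℚ) ^ finrank F U) =
      ∑ v ∈ s, ((selfOrthogonalAbove B (U ⊔ Submodule.span F {v}) k).ncard : ℚ) := by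
  classical
  have : Finite V := Module.finite_of_finite F
  have hfin : (selfOrthogonalAbove B U k).Finite := Set.toFinite _
  have key := Finset.sum_card_bipartiteAbove_eq_sum_card_bipartiteBelow
    (s := s) (t := hfin.toFinset) (fun v C => v ∈ C)
  have habove : ∀ v ∈ s, (hfin.toFinset.bipartiteAbove (fun v C => v ∈ C) v).card =
      (selfOrthogonalAbove B (U ⊔ Submodule.span F {v}) k).ncard := by
    intro v _
    rw [← Set.ncard_coe_finset]
    congr 1
    ext C
    simp only [Finset.bipartiteAbove, Finset.coe_filter, Set.Finite.mem_toFinset,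
      selfOrthogonalAbove, Set.mem_ofPred_eq, sup_span_singleton_le]
    tauto
  have hbelow : ∀ C ∈ hfin.toFinset, ((s.bipartiteBelow (fun v C => v ∈ C) C).card : ℚ) =
      (Fintype.card F : ℚ) ^ k - (Fintype.card F : ℚ) ^ finrank F U := by
    intro C hC
    obtain ⟨h1, h2, h3⟩ := hfin.mem_toFinset.1 hC
    have h4 := ncard_submodule_diff h1
    -- Every vector of `C` is isotropic and orthogonal to `U`, so all of `C \ U` is counted by `s`.
    have h5 : ((C : Set V) \ U) = (s.bipartiteBelow (fun v C => v ∈ C) C : Set V) := by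
      ext v
      have hv : v ∈ s ↔ v ∈ isotropicOrthogonal B U \ U := by rw [← hs]; rfl
      simp only [Finset.bipartiteBelow, Finset.coe_filter, Set.mem_ofPred_eq, hv, Set.mem_sdiff,
        SetLike.mem_coe]
      exact ⟨fun h => ⟨⟨h2.subset_isotropicOrthogonal h1 h.1, h.2⟩, h.1⟩,
        fun h => ⟨h.2, h.1.2⟩⟩
    rw [h5, Set.ncard_coe_finset, h3] at h4
    rw [eq_sub_iff_add_eq]
    exact_mod_cast h4
  rw [Finset.sum_congr rfl habove] at key
  have key' := congrArg (Nat.cast : ℕ → ℚ) key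
  push_cast at key'
  rw [key', Finset.sum_congr rfl hbelow, Finset.sum_const, nsmul_eq_mul,
    Set.ncard_eq_toFinset_card _ hfin]

theorem ncard_isotropicOrthogonal_diff {B : LinearMap.BilinForm F V} {U : Submodule F V}
    (h : IsSelfOrthogonal B U) {s : Finset V} (hs : (s : Set V) = isotropicOrthogonal B U \ U) :
    (s.card : ℚ) =
      (isotropicOrthogonal B U).ncard - (Fintype.card F : ℚ) ^ finrank F U := by
  have : Finite V := Module.finite_of_finite F
  rw [eq_sub_iff_add_eq, ← Set.ncard_coe_finset, hs]
  have := Set.ncard_sdiff_add_ncard_of_subset (h.subset_isotropicOrthogonal le_rfl)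
  rw [ncard_coe_submodule] at this
  exact_mod_cast this

/-- If all extensions of `U` by an isotropic vector lie in the same number of self-orthogonal
`k`-dimensional subspaces, then this determines the number for `U`. -/
theorem ncard_selfOrthogonalAbove_mul_of_const {B : LinearMap.BilinForm F V}
    {U : Submodule F V} (h : IsSelfOrthogonal B U) {k : ℕ} {c : ℚ}
    (hc : ∀ v ∈ isotropicOrthogonal B U \ U,
      ((selfOrthogonalAbove B (U ⊔ Submodule.span F {v}) k).ncard : ℚ) = c) :
    ((selfOrthogonalAbove B U k).ncard : ℚ) *
        ((Fintype.card F : ℚ) ^ k - (Fintype.card F : ℚ) ^ finrank F U) =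
      ((isotropicOrthogonal B U).ncard - (Fintype.card F : ℚ) ^ finrank F U) * c := by
  have : Finite V := Module.finite_of_finite F
  have hs := (Set.toFinite (isotropicOrthogonal B U \ U)).coe_toFinset
  rw [ncard_selfOrthogonalAbove_mul B U k hs, ← ncard_isotropicOrthogonal_diff h hs,
    Finset.sum_congr rfl fun v hv => hc v ((Set.Finite.mem_toFinset _).1 hv),
    Finset.sum_const, nsmul_eq_mul]

end Counting

end BilinearCodes
namespace BilinearCodes

/-! ### Isotropic vectors in odd characteristic -/

section OddCharacteristic

open Module

variable {F V : Type*} [Field F] [Fintype F] [AddCommGroup V] [Module F V]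
  [FiniteDimensional F V]

/-- Every `x` in the orthogonal of `U` that is not orthogonal to the isotropic vector `v` has
exactly one isotropic translate `x + a • v`. -/
theorem ncard_isotropicOrthogonal_sup_span_singleton {B : LinearMap.BilinForm F V}
    (hs : B.IsSymm) (hB : B.Nondegenerate) (h2 : (2 : F) ≠ 0) {U : Submodule F V}
    (h : IsSelfOrthogonal B U) {v : V} (hv : v ∈ isotropicOrthogonal B U \ U) :
    (isotropicOrthogonal B U).ncard + Fintype.card F ^ (finrank F V - finrank F U - 2) =
      (isotropicOrthogonal B (U ⊔ Submodule.span F {v})).ncard +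
        Fintype.card F ^ (finrank F V - finrank F U - 1) := by
  have : Finite V := Module.finite_of_finite F
  set U' := U ⊔ Submodule.span F {v} with hU'
  have hU'dim : finrank F U' = finrank F U + 1 := Submodule.finrank_sup_span_singleton hv.2
  have hU's : IsSelfOrthogonal B U' := h.sup_span_singleton hs hv.1
  have hle := hU's.two_mul_finrank_le hB
  have hUU' : U ≤ U' := le_sup_left
  have hvU' : v ∈ U' := (sup_span_singleton_le.1 le_rfl).2
  have horth : B.orthogonal U' ≤ B.orthogonal U := fun x hx y hy => hx y (hUU' hy)
  have mem_orth : ∀ x, x ∈ B.orthogonal U' ↔ x ∈ B.orthogonal U ∧ B v x = 0 := by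
    refine fun x => ⟨fun hx => ⟨horth hx, hx v hvU'⟩, fun ⟨h1, h3⟩ y hy => ?_⟩
    obtain ⟨y', hy', b, hb, rfl⟩ := Submodule.mem_sup.1 hy
    obtain ⟨b, rfl⟩ := Submodule.mem_span_singleton.1 hb
    have : B y' x = 0 := h1 y' hy'
    simp [this, h3]
  have hvv : B v v = 0 := hv.1.2
  -- Since `v` is isotropic, the form is affine in `a`, with slope nonzero exactly when `x` is not
  -- orthogonal to `v`.
  have hQ : ∀ x (a : F), B (x + a • v) (x + a • v) = B x x + a * (2 * B v x) := by
    intro x a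
    have := hs.eq x v
    simp only [map_add, LinearMap.add_apply, map_smul, LinearMap.smul_apply, smul_eq_mul, hvv,
      this]
    ring
  set S : Set V := isotropicOrthogonal B U \ isotropicOrthogonal B U' with hS
  have memS : ∀ x, x ∈ S ↔ x ∈ B.orthogonal U ∧ B x x = 0 ∧ B v x ≠ 0 := by
    intro x
    simp only [hS, isotropicOrthogonal, Set.mem_sdiff, Set.mem_ofPred_eq, mem_orth]
    tauto
  have hsub : isotropicOrthogonal B U' ⊆ isotropicOrthogonal B U := fun x hx => ⟨horth hx.1, hx.2⟩
  have hcard := Set.ncard_sdiff_add_ncard_of_subset hsub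
  have hX : ((B.orthogonal U : Set V) \ B.orthogonal U') =
      (fun p : V × F => p.1 + p.2 • v) '' (S ×ˢ Set.univ) := by
    ext x
    simp only [Set.mem_sdiff, SetLike.mem_coe, mem_orth, Set.mem_image, Set.mem_prod, memS,
      Set.mem_univ, and_true, Prod.exists]
    constructor
    · rintro ⟨h1, h3⟩
      have h4 : B v x ≠ 0 := fun h5 => h3 ⟨h1, h5⟩
      -- The coefficient is the root of the affine equation in `hQ`.
      refine ⟨x + (-(B x x / (2 * B v x))) • v, B x x / (2 * B v x), ⟨?_, ?_, ?_⟩, ?_⟩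
      · exact add_mem h1 (Submodule.smul_mem _ _ hv.1.1)
      · rw [hQ]; field_simp; ring
      · simpa [hvv] using h4
      · rw [add_assoc, ← add_smul]; simp
    · rintro ⟨y, a, ⟨h1, h3, h4⟩, rfl⟩
      refine ⟨add_mem h1 (Submodule.smul_mem _ _ hv.1.1), fun h5 => h4 ?_⟩
      simpa [hvv] using h5.2
  have hinj : Set.InjOn (fun p : V × F => p.1 + p.2 • v) (S ×ˢ Set.univ) := by
    rintro ⟨x, a⟩ hx ⟨y, b⟩ hy hxy
    simp only [Set.mem_prod, memS, Set.mem_univ, and_true] at hx hy hxy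
    have hxe : x = y + (b - a) • v := by
      rw [sub_smul, ← add_sub_assoc, ← hxy, add_sub_cancel_right]
    have h5 := hQ y (b - a)
    rw [← hxe, hx.2.1, hy.2.1, zero_add, eq_comm, mul_eq_zero] at h5
    have h6 : b - a = 0 := h5.resolve_right (mul_ne_zero h2 hy.2.2)
    have h7 : b = a := sub_eq_zero.1 h6
    simp [hxe, h7]
  have hXcard := ncard_submodule_diff horth
  rw [hX, hinj.ncard_image, Set.ncard_prod, Set.ncard_univ, Nat.card_eq_fintype_card,
    LinearMap.BilinForm.finrank_orthogonal hB, LinearMap.BilinForm.finrank_orthogonal hB,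
    hU'dim] at hXcard
  have hq : 0 < Fintype.card F := Fintype.card_pos
  obtain ⟨m, hm⟩ : ∃ m, finrank F V = finrank F U + m + 2 :=
    ⟨finrank F V - finrank F U - 2, by omega⟩
  have e1 : finrank F V - finrank F U = m + 2 := by omega
  have e2 : finrank F V - (finrank F U + 1) = m + 1 := by omega
  rw [e1, e2] at hXcard
  rw [e1]
  have key : S.ncard + Fintype.card F ^ m = Fintype.card F ^ (m + 1) := by
    apply Nat.eq_of_mul_eq_mul_right hq
    rw [add_mul, ← pow_succ, ← pow_succ]
    exact hXcard
  rw [show m + 2 - 2 = m by omega, show m + 2 - 1 = m + 1 by omega]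
  linarith

/-- The one-step identity telescopes along a chain from `U` to `W`, adding one vector of `W` at a
time. -/
theorem ncard_isotropicOrthogonal_of_le {B : LinearMap.BilinForm F V}
    (hs : B.IsSymm) (hB : B.Nondegenerate) (h2 : (2 : F) ≠ 0) {W : Submodule F V}
    (hW : IsSelfOrthogonal B W) (d : ℕ) :
    ∀ U : Submodule F V, U ≤ W → finrank F W = finrank F U + d →
    (isotropicOrthogonal B U).ncard + Fintype.card F ^ (finrank F V - finrank F W - 1) =
      (isotropicOrthogonal B W).ncard + Fintype.card F ^ (finrank F V - finrank F U - 1) := by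
  induction d with
  | zero =>
    intro U hUW hd
    rw [Submodule.eq_of_le_of_finrank_eq hUW hd.symm]
  | succ d ih =>
    intro U hUW hd
    obtain ⟨v, hvW, hvU⟩ : ∃ v ∈ W, v ∉ U := by
      by_contra! hcon
      have := Submodule.finrank_mono (show W ≤ U from hcon)
      omega
    have hv : v ∈ isotropicOrthogonal B U \ U := ⟨hW.subset_isotropicOrthogonal hUW hvW, hvU⟩
    have hdim := Submodule.finrank_sup_span_singleton (K := F) hvU
    have h3 := ih _ (sup_span_singleton_le.2 ⟨hUW, hvW⟩) (by rw [hdim, hd]; ring)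
    have h4 := ncard_isotropicOrthogonal_sup_span_singleton hs hB h2 (hW.mono hUW) hv
    rw [hdim, show finrank F V - (finrank F U + 1) - 1 = finrank F V - finrank F U - 2 by omega]
      at h3
    omega

theorem ncard_isotropicOrthogonal_of_two_ne_zero {B : LinearMap.BilinForm F V}
    (hs : B.IsSymm) (hB : B.Nondegenerate) (h2 : (2 : F) ≠ 0) {U : Submodule F V}
    (hU : IsSelfOrthogonal B U) :
    (isotropicOrthogonal B U).ncard + Fintype.card F ^ (finrank F V - wittIndex B - 1) =
      Fintype.card F ^ wittIndex B + Fintype.card F ^ (finrank F V - finrank F U - 1) := by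
  obtain ⟨W, hW, hWdim⟩ := exists_finrank_eq_wittIndex B
  -- `U` need not lie in the maximal `W`, so both are compared with `⊥`.
  have h3 := ncard_isotropicOrthogonal_of_le hs hB h2 hW (finrank F W) ⊥ bot_le (by simp)
  have h4 := ncard_isotropicOrthogonal_of_le hs hB h2 hU (finrank F U) ⊥ bot_le (by simp)
  rw [isotropicOrthogonal_eq_of_finrank_eq_wittIndex hs hW hWdim, ncard_coe_submodule,
    hWdim] at h3
  omega

end OddCharacteristic

end BilinearCodes
namespace BilinearCodes

/-! ### Solving the recursions -/

section Recursions

open Module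

theorem tau_eq_prod_range (q n d w : ℕ) :
    tau q n d w = (∏ i ∈ Finset.range d,
      (((q : ℚ) ^ (n - w - (i + 1)) + 1) * ((q : ℚ) ^ (w - i) - 1))) /
        ∏ i ∈ Finset.range d, ((q : ℚ) ^ (i + 1) - 1) := by
  rw [← Finset.prod_div_distrib]
  induction d with
  | zero => simp [tau]
  | succ d ih =>
    rw [Finset.prod_range_succ, ← ih, tau, Finset.prod_Icc_succ_top (by omega), ← tau,
      show w + 1 - (d + 1) = w - d by omega]

/-- Passing from (n, w) to (n + 2, w + 1) shifts the numerators by one index but leaves the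
denominators alone: the new numerator factor is the first, the new denominator factor the last. -/
theorem tau_succ {q : ℕ} (hq : 1 < q) (n d w : ℕ) :
    tau q (n + 2) (d + 1) (w + 1) * ((q : ℚ) ^ (d + 1) - 1) =
      ((q : ℚ) ^ (n - w) + 1) * ((q : ℚ) ^ (w + 1) - 1) * tau q n d w := by
  have hq' : (1 : ℚ) < q := by exact_mod_cast hq
  have hne : ∀ i, (q : ℚ) ^ (i + 1) - 1 ≠ 0 := fun i =>
    sub_ne_zero.2 (one_lt_pow₀ hq' (Nat.succ_ne_zero i)).ne'
  have hne' : ∏ i ∈ Finset.range d, ((q : ℚ) ^ (i + 1) - 1) ≠ 0 :=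
    Finset.prod_ne_zero_iff.2 fun i _ => hne i
  rw [tau_eq_prod_range, tau_eq_prod_range, Finset.prod_range_succ', Finset.prod_range_succ
    (fun i => (q : ℚ) ^ (i + 1) - 1)]
  have h1 : ∀ i, n + 2 - (w + 1) - (i + 1 + 1) = n - w - (i + 1) := fun i => by omega
  have h2 : ∀ i, w + 1 - (i + 1) = w - i := fun i => by omega
  have h3 : n + 2 - (w + 1) - (0 + 1) = n - w := by omega
  simp only [h1, h2, h3, Nat.sub_zero]
  have := hne d
  field_simp

/-- The number of `d`-dimensional totally isotropic subspaces of an `m`-dimensional symplectic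
space over a field with `q` elements. -/
def symplecticCount (q : ℚ) : ℕ → ℕ → ℚ
  | 0, _ => 1
  | d + 1, m => (q ^ m - 1) / (q ^ (d + 1) - 1) * symplecticCount q d (m - 2)

/-- The number of `d`-dimensional self-orthogonal subspaces of an `m`-dimensional
non-alternating space of even dimension over a field with `q` elements, `q` even. -/
def nonalternatingCount (q : ℚ) : ℕ → ℕ → ℚ
  | 0, _ => 1
  | d + 1, m => ((q ^ (m - 1) - q) * nonalternatingCount q d (m - 2) +
      (q - 1) * symplecticCount q d (m - 2)) / (q ^ (d + 1) - 1)

variable {F V : Type*} [Field F] [Fintype F] [AddCommGroup V] [Module F V]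
  [FiniteDimensional F V]

theorem card_pow_succ_sub_one_ne_zero (F : Type*) [Field F] [Fintype F] (d : ℕ) :
    (Fintype.card F : ℚ) ^ (d + 1) - 1 ≠ 0 := by
  have hq : (1 : ℚ) < Fintype.card F := by exact_mod_cast Fintype.one_lt_card
  exact sub_ne_zero.2 (one_lt_pow₀ hq (Nat.succ_ne_zero d)).ne'

theorem card_pow_ne_zero (F : Type*) [Field F] [Fintype F] (d : ℕ) :
    (Fintype.card F : ℚ) ^ d ≠ 0 :=
  pow_ne_zero _ (by exact_mod_cast Fintype.card_ne_zero)

/-- Only the formula for the isotropic count enters, so odd q and the case of q even, n odd are both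
covered. -/
theorem ncard_selfOrthogonalAbove_eq_tau {B : LinearMap.BilinForm F V} (hs : B.IsSymm)
    {w : ℕ} (hw : 2 * w ≤ finrank F V)
    (hI : ∀ U : Submodule F V, IsSelfOrthogonal B U →
      (isotropicOrthogonal B U).ncard + Fintype.card F ^ (finrank F V - w - 1) =
        Fintype.card F ^ w + Fintype.card F ^ (finrank F V - finrank F U - 1)) (d : ℕ) :
    ∀ U : Submodule F V, IsSelfOrthogonal B U → finrank F U + d ≤ w →
      ((selfOrthogonalAbove B U (finrank F U + d)).ncard : ℚ) =
        tau (Fintype.card F) (finrank F V - 2 * finrank F U) d (w - finrank F U) := by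
  induction d with
  | zero =>
    intro U hU _
    rw [add_zero, selfOrthogonalAbove_self hU]
    simp [tau]
  | succ d ih =>
    intro U hU hle
    have key := ncard_selfOrthogonalAbove_mul_of_const hU (k := finrank F U + (d + 1))
      (c := tau (Fintype.card F) (finrank F V - 2 * (finrank F U + 1)) d
        (w - (finrank F U + 1))) (by
      intro v hv
      have hdim := Submodule.finrank_sup_span_singleton (K := F) hv.2
      have := ih _ (hU.sup_span_singleton hs hv.1) (by omega)
      rwa [hdim, show finrank F U + 1 + d = finrank F U + (d + 1) by ring] at this)
    have hIU : ((isotropicOrthogonal B U).ncard : ℚ) +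
        (Fintype.card F : ℚ) ^ (finrank F V - w - 1) = (Fintype.card F : ℚ) ^ w +
        (Fintype.card F : ℚ) ^ (finrank F V - finrank F U - 1) := by exact_mod_cast hI U hU
    -- These parameters remove truncated subtraction; the number of admissible vectors becomes q^t
    -- (q^(w₀+1) - 1)(q^j + 1), matching `tau_succ`.
    obtain ⟨w₀, hw₀⟩ : ∃ w₀, w = finrank F U + 1 + w₀ := ⟨w - (finrank F U + 1), by omega⟩
    obtain ⟨j, hj⟩ : ∃ j, finrank F V = 2 * finrank F U + 2 + (w₀ + j) :=
      ⟨finrank F V - (2 * finrank F U + 2 + w₀), by omega⟩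
    generalize finrank F U = t at *
    generalize finrank F V = n at *
    subst hj hw₀
    rw [show 2 * t + 2 + (w₀ + j) - (t + 1 + w₀) - 1 = t + j by omega,
      show 2 * t + 2 + (w₀ + j) - t - 1 = t + 1 + w₀ + j by omega] at hIU
    rw [show 2 * t + 2 + (w₀ + j) - 2 * (t + 1) = w₀ + j by omega,
      show t + 1 + w₀ - (t + 1) = w₀ by omega] at key
    rw [show 2 * t + 2 + (w₀ + j) - 2 * t = w₀ + j + 2 by omega,
      show t + 1 + w₀ - t = w₀ + 1 by omega]
    have htau := tau_succ (Fintype.one_lt_card (α := F)) (w₀ + j) d w₀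
    rw [Nat.add_sub_cancel_left] at htau
    have h1 := card_pow_succ_sub_one_ne_zero F d
    have h2 := card_pow_ne_zero F t
    apply mul_right_cancel₀ (mul_ne_zero h2 h1)
    rw [eq_sub_of_add_eq hIU] at key
    linear_combination key - (Fintype.card F : ℚ) ^ t * htau

/-- `P` survives enlargement, so one recursion suffices. It serves for `e ∈ U` with `c = 0`, and for
odd dimension with `P` trivial and `c = 1`. -/
theorem ncard_selfOrthogonalAbove_eq_symplecticCount {B : LinearMap.BilinForm F V}
    (hs : B.IsSymm) (P : Submodule F V → Prop) (hP : ∀ U U', U ≤ U' → P U → P U') (c : ℕ)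
    (hc : ∀ U : Submodule F V, IsSelfOrthogonal B U → P U → 2 * finrank F U + c ≤ finrank F V)
    (hI : ∀ U : Submodule F V, IsSelfOrthogonal B U → P U →
      (isotropicOrthogonal B U).ncard = Fintype.card F ^ (finrank F V - finrank F U - c))
    (d : ℕ) :
    ∀ U : Submodule F V, IsSelfOrthogonal B U → P U →
      ((selfOrthogonalAbove B U (finrank F U + d)).ncard : ℚ) =
        symplecticCount (Fintype.card F) d (finrank F V - 2 * finrank F U - c) := by
  induction d with
  | zero =>
    intro U hU _
    rw [add_zero, selfOrthogonalAbove_self hU]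
    simp [symplecticCount]
  | succ d ih =>
    intro U hU hPU
    have key := ncard_selfOrthogonalAbove_mul_of_const hU (k := finrank F U + (d + 1))
      (c := symplecticCount (Fintype.card F) d (finrank F V - 2 * finrank F U - c - 2)) (by
      intro v hv
      have hdim := Submodule.finrank_sup_span_singleton (K := F) hv.2
      have := ih _ (hU.sup_span_singleton hs hv.1) (hP _ _ le_sup_left hPU)
      rwa [hdim, show finrank F U + 1 + d = finrank F U + (d + 1) by ring,
        show finrank F V - 2 * (finrank F U + 1) - c = finrank F V - 2 * finrank F U - c - 2
          by omega] at this)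
    obtain ⟨j, hj⟩ : ∃ j, finrank F V = 2 * finrank F U + c + j :=
      Nat.exists_eq_add_of_le (hc U hU hPU)
    rw [hI U hU hPU] at key
    generalize finrank F U = t at *
    generalize finrank F V = n at *
    subst hj
    rw [show 2 * t + c + j - t - c = t + j by omega,
      show 2 * t + c + j - 2 * t - c = j by omega] at key
    rw [show 2 * t + c + j - 2 * t - c = j by omega, symplecticCount]
    have h1 := card_pow_succ_sub_one_ne_zero F d
    have h2 := card_pow_ne_zero F t
    rw [div_mul_eq_mul_div, eq_div_iff h1]
    apply mul_right_cancel₀ h2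
    push_cast at key
    linear_combination key

end Recursions

/-! ### Isotropy as a linear condition: even characteristic -/

section EvenCharacteristic

open Module

variable {F V : Type*} [Field F] [Fintype F] [AddCommGroup V] [Module F V]
  [FiniteDimensional F V]

theorem ncard_isotropicOrthogonal_of_mem {B : LinearMap.BilinForm F V} (hB : B.Nondegenerate)
    {e : V} (he : ∀ v, B v v = 0 ↔ B e v = 0) {U : Submodule F V} (heU : e ∈ U) :
    (isotropicOrthogonal B U).ncard = Fintype.card F ^ (finrank F V - finrank F U) := by
  rw [isotropicOrthogonal_eq_orthogonal he, ncard_coe_submodule,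
    LinearMap.BilinForm.finrank_orthogonal hB,
    sup_eq_left.2 ((Submodule.span_singleton_le_iff_mem _ _).2 heU)]

theorem ncard_isotropicOrthogonal_of_notMem {B : LinearMap.BilinForm F V}
    (hB : B.Nondegenerate) {e : V} (he : ∀ v, B v v = 0 ↔ B e v = 0) {U : Submodule F V}
    (heU : e ∉ U) :
    (isotropicOrthogonal B U).ncard = Fintype.card F ^ (finrank F V - finrank F U - 1) := by
  rw [isotropicOrthogonal_eq_orthogonal he, ncard_coe_submodule,
    LinearMap.BilinForm.finrank_orthogonal hB, Submodule.finrank_sup_span_singleton heU,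
    Nat.sub_sub]

/-- When `e ∈ U`, the form is alternating on the orthogonal of `U`, hence the symplectic count. -/
theorem ncard_selfOrthogonalAbove_of_mem {B : LinearMap.BilinForm F V} (hs : B.IsSymm)
    (hB : B.Nondegenerate) {e : V} (he : ∀ v, B v v = 0 ↔ B e v = 0) {U : Submodule F V}
    (hU : IsSelfOrthogonal B U) (heU : e ∈ U) (d : ℕ) :
    ((selfOrthogonalAbove B U (finrank F U + d)).ncard : ℚ) =
      symplecticCount (Fintype.card F) d (finrank F V - 2 * finrank F U) :=
  ncard_selfOrthogonalAbove_eq_symplecticCount hs (e ∈ ·) (fun _ _ h h' => h h') 0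
    (fun _ h _ => h.two_mul_finrank_le hB)
    (fun _ _ h => ncard_isotropicOrthogonal_of_mem hB he h) d U hU heU

theorem ncard_selfOrthogonalAbove_of_odd {B : LinearMap.BilinForm F V} (hs : B.IsSymm)
    (hB : B.Nondegenerate) {e : V} (he : ∀ v, B v v = 0 ↔ B e v = 0) (hee : B e e ≠ 0)
    (hodd : Odd (finrank F V)) {U : Submodule F V} (hU : IsSelfOrthogonal B U) (d : ℕ) :
    ((selfOrthogonalAbove B U (finrank F U + d)).ncard : ℚ) =
      symplecticCount (Fintype.card F) d (finrank F V - 2 * finrank F U - 1) := by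
  refine ncard_selfOrthogonalAbove_eq_symplecticCount hs (fun _ => True) (fun _ _ _ h => h) 1
    (fun W hW _ => ?_) (fun W hW _ => ?_) d U hU trivial
  · have := hW.two_mul_finrank_le hB
    obtain ⟨m, hm⟩ := hodd
    omega
  · exact ncard_isotropicOrthogonal_of_notMem hB he fun h => hee (hW.apply_eq_zero h h)

/-- The admissible `v` split in two: q^(t+1) - q^t of them put `e` into the extension and contribute
symplectic counts; the other q^(n-t-1) - q^(t+1) keep `e` outside, and induction applies. -/
theorem ncard_selfOrthogonalAbove_of_notMem {B : LinearMap.BilinForm F V} (hs : B.IsSymm)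
    (hB : B.Nondegenerate) {e : V} (he : ∀ v, B v v = 0 ↔ B e v = 0) (hee : B e e = 0)
    (d : ℕ) : ∀ U : Submodule F V, IsSelfOrthogonal B U → e ∉ U →
    ((selfOrthogonalAbove B U (finrank F U + d)).ncard : ℚ) =
      nonalternatingCount (Fintype.card F) d (finrank F V - 2 * finrank F U) := by
  classical
  induction d with
  | zero =>
    intro U hU _
    rw [add_zero, selfOrthogonalAbove_self hU]
    simp [nonalternatingCount]
  | succ d ih =>
    intro U hU heU
    have : Finite V := Module.finite_of_finite F
    have hscoe := (Set.toFinite (isotropicOrthogonal B U \ U)).coe_toFinset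
    set s := (Set.toFinite (isotropicOrthogonal B U \ U)).toFinset
    have mems : ∀ v, v ∈ s ↔ v ∈ isotropicOrthogonal B U \ U := fun v => by rw [← hscoe]; rfl
    have heI : e ∈ isotropicOrthogonal B U := by
      refine ⟨fun u hu => ?_, hee⟩
      rw [hs.eq u e, ← he]
      exact hU.apply_eq_zero hu hu
    set U' := U ⊔ Submodule.span F {e} with hU'
    have hU's : IsSelfOrthogonal B U' := hU.sup_span_singleton hs heI
    have hU'dim : finrank F U' = finrank F U + 1 := Submodule.finrank_sup_span_singleton heU
    have hle := hU's.two_mul_finrank_le hB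
    have hUU' : U ≤ U' := le_sup_left
    have heU' : e ∈ U' := (sup_span_singleton_le.1 le_rfl).2
    -- Exchange property: for `v ∉ U`, `e ∈ U + ⟨v⟩` if and only if `v ∈ U + ⟨e⟩`.
    have hfilter : ((s.filter fun v => e ∈ U ⊔ Submodule.span F {v}) : Set V) =
        (U' : Set V) \ U := by
      ext v
      simp only [Finset.coe_filter, Set.mem_ofPred_eq, mems, Set.mem_sdiff, SetLike.mem_coe]
      constructor
      · rintro ⟨⟨-, h1⟩, h3⟩
        refine ⟨?_, h1⟩
        have h4 : U' ≤ U ⊔ Submodule.span F {v} := sup_span_singleton_le.2 ⟨le_sup_left, h3⟩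
        rw [Submodule.eq_of_le_of_finrank_eq h4
          (by rw [hU'dim, Submodule.finrank_sup_span_singleton h1])]
        exact (sup_span_singleton_le.1 le_rfl).2
      · rintro ⟨h1, h3⟩
        refine ⟨⟨hU's.subset_isotropicOrthogonal hUU' h1, h3⟩, ?_⟩
        have h4 : U ⊔ Submodule.span F {v} ≤ U' := sup_span_singleton_le.2 ⟨hUU', h1⟩
        rw [Submodule.eq_of_le_of_finrank_eq h4
          (by rw [hU'dim, Submodule.finrank_sup_span_singleton h3])]
        exact heU'
    have hcard₁ : ((s.filter fun v => e ∈ U ⊔ Submodule.span F {v}).card : ℚ) =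
        (Fintype.card F : ℚ) ^ (finrank F U + 1) - (Fintype.card F : ℚ) ^ finrank F U := by
      have := ncard_submodule_diff hUU'
      rw [← hfilter, Set.ncard_coe_finset, hU'dim] at this
      rw [eq_sub_iff_add_eq]
      exact_mod_cast this
    have hcard := ncard_isotropicOrthogonal_diff hU hscoe
    rw [ncard_isotropicOrthogonal_of_notMem hB he heU] at hcard
    have hcard₂ := Finset.card_filter_add_card_filter_not (s := s)
      (fun v => e ∈ U ⊔ Submodule.span F {v})
    have hcard₂' : ((s.filter fun v => e ∈ U ⊔ Submodule.span F {v}).card : ℚ) +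
      ((s.filter fun v => ¬ e ∈ U ⊔ Submodule.span F {v}).card : ℚ) = s.card := by
      exact_mod_cast hcard₂
    have key := ncard_selfOrthogonalAbove_mul B U (finrank F U + (d + 1)) hscoe
    have harith : finrank F V - 2 * (finrank F U + 1) = finrank F V - 2 * finrank F U - 2 := by
      omega
    rw [← Finset.sum_filter_add_sum_filter_not s (fun v => e ∈ U ⊔ Submodule.span F {v}),
      Finset.sum_congr (g := fun _ => symplecticCount (Fintype.card F) d
        (finrank F V - 2 * finrank F U - 2)) rfl, Finset.sum_congr (s₁ := s.filter fun v =>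
          ¬ e ∈ U ⊔ Submodule.span F {v}) (g := fun _ => nonalternatingCount (Fintype.card F) d
        (finrank F V - 2 * finrank F U - 2)) rfl, Finset.sum_const, Finset.sum_const,
      nsmul_eq_mul, nsmul_eq_mul, eq_sub_of_add_eq' hcard₂', hcard₁, hcard] at key
    rotate_left
    · intro v hv
      rw [Finset.mem_filter, mems] at hv
      have := ih _ (hU.sup_span_singleton hs hv.1.1) hv.2
      rwa [Submodule.finrank_sup_span_singleton hv.1.2, harith,
        show finrank F U + 1 + d = finrank F U + (d + 1) by ring] at this
    · intro v hv
      rw [Finset.mem_filter, mems] at hv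
      have := ncard_selfOrthogonalAbove_of_mem hs hB he (hU.sup_span_singleton hs hv.1.1) hv.2 d
      rwa [Submodule.finrank_sup_span_singleton hv.1.2, harith,
        show finrank F U + 1 + d = finrank F U + (d + 1) by ring] at this
    obtain ⟨j, hj⟩ : ∃ j, finrank F V = 2 * finrank F U + 2 + j :=
      ⟨finrank F V - (2 * finrank F U + 2), by omega⟩
    rw [nonalternatingCount]
    generalize finrank F U = t at *
    generalize finrank F V = n at *
    subst hj
    rw [show 2 * t + 2 + j - t - 1 = t + 1 + j by omega,
      show 2 * t + 2 + j - 2 * t - 2 = j by omega] at key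
    rw [show 2 * t + 2 + j - 2 * t - 2 = j by omega,
      show 2 * t + 2 + j - 2 * t - 1 = j + 1 by omega]
    have h1 := card_pow_succ_sub_one_ne_zero F d
    have h2 := card_pow_ne_zero F t
    rw [eq_div_iff h1]
    apply mul_right_cancel₀ h2
    push_cast at key
    linear_combination key

/-- In even characteristic and odd dimension the Witt index is `(n - 1) / 2`. -/
theorem finrank_eq_two_mul_wittIndex_add_one {B : LinearMap.BilinForm F V} (hs : B.IsSymm)
    (hB : B.Nondegenerate) {e : V} (he : ∀ v, B v v = 0 ↔ B e v = 0) (hee : B e e ≠ 0)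
    (hodd : Odd (finrank F V)) : finrank F V = 2 * wittIndex B + 1 := by
  obtain ⟨W, hW, hWdim⟩ := exists_finrank_eq_wittIndex B
  have h1 := ncard_isotropicOrthogonal_of_notMem hB he
    fun h => hee (hW.apply_eq_zero (C := W) h h)
  rw [isotropicOrthogonal_eq_of_finrank_eq_wittIndex hs hW hWdim, ncard_coe_submodule,
    hWdim] at h1
  have h2 := Nat.pow_right_injective (Fintype.one_lt_card (α := F)) h1
  -- Positivity excludes dimension 0, where truncated subtraction would satisfy `h2`.
  have h3 := hodd.pos
  have h4 := hW.two_mul_finrank_le hB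
  omega

end EvenCharacteristic

/-! ### The standard inner product -/

section StandardForm

open Module

theorem stdForm_apply {F : Type*} [Field F] (n : ℕ) (x y : Fin n → F) :
    stdForm F n x y = ∑ i, x i * y i := rfl

theorem stdForm_isSymm (F : Type*) [Field F] (n : ℕ) : (stdForm F n).IsSymm :=
  ⟨fun x y => by simp only [stdForm_apply, mul_comm]⟩

theorem stdForm_nondegenerate (F : Type*) [Field F] (n : ℕ) : (stdForm F n).Nondegenerate :=
  ⟨fun x hx => dotProduct_eq_zero x hx, fun y hy => dotProduct_eq_zero y fun x => by
    rw [dotProduct_comm]; exact hy x⟩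

/-- Squaring is additive in characteristic 2, so Σ vᵢ² = (Σ vᵢ)². -/
theorem stdForm_self_eq_zero_iff {F : Type*} [Field F] [CharP F 2] (n : ℕ) (v : Fin n → F) :
    stdForm F n v v = 0 ↔ stdForm F n 1 v = 0 := by
  simp only [stdForm_apply, Pi.one_apply, one_mul, ← pow_two]
  rw [← CharTwo.sum_sq, pow_eq_zero_iff two_ne_zero]

theorem stdForm_one_one (F : Type*) [Field F] (n : ℕ) : stdForm F n 1 1 = n := by
  simp [stdForm_apply]

theorem setOf_selfOrthogonalCodes_le {F : Type*} [Field F] (n k : ℕ)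
    (U : Submodule F (Fin n → F)) :
    {C ∈ selfOrthogonalCodes F n k | U ≤ C} = selfOrthogonalAbove (stdForm F n) U k := by
  ext C
  simp only [selfOrthogonalCodes, selfOrthogonalAbove, Set.mem_ofPred_eq,
    mem_complementarySubspaces_self]
  tauto

theorem numSelfOrthogonalCodes_eq (F : Type*) [Field F] (n k : ℕ) :
    numSelfOrthogonalCodes F n k = (selfOrthogonalAbove (stdForm F n) ⊥ k).ncard := by
  rw [← setOf_selfOrthogonalCodes_le]
  simp [numSelfOrthogonalCodes]

theorem two_ne_zero_of_odd_card {F : Type*} [Field F] [Fintype F] (h : Odd (Fintype.card F)) :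
    (2 : F) ≠ 0 := by
  refine Ring.two_ne_zero fun h2 => ?_
  have := FiniteField.even_card_of_char_two h2
  rw [Nat.odd_iff] at h
  omega

theorem charP_two_of_not_odd_card {F : Type*} [Field F] [Fintype F]
    (h : ¬ Odd (Fintype.card F)) : CharP F 2 := by
  rw [Nat.not_odd_iff, ← FiniteField.even_card_iff_char_two] at h
  exact ringChar.of_eq h

end StandardForm

end BilinearCodes
-- The extension counts by type
theorem mainTheorem10 {F : Type*} [Field F] [Fintype F] (n k t w : ℕ) (hn : 1 ≤ n)
    (hw : w = BilinearCodes.wittIndex (BilinearCodes.stdForm F n))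
    (htk : t ≤ k) (hkw : k ≤ w)
    (U : Submodule F (Fin n → F)) (hUdim : Module.finrank F U = t)
    (hU : BilinearCodes.IsSelfOrthogonal (BilinearCodes.stdForm F n) U) :
    ((BilinearCodes.bilinType (BilinearCodes.stdForm F n) = BilinearCodes.BilinType.P ∨
        BilinearCodes.bilinType (BilinearCodes.stdForm F n) = BilinearCodes.BilinType.H ∨
        BilinearCodes.bilinType (BilinearCodes.stdForm F n) = BilinearCodes.BilinType.E ∨
        BilinearCodes.bilinType (BilinearCodes.stdForm F n) = BilinearCodes.BilinType.N1) →
      ({C ∈ BilinearCodes.selfOrthogonalCodes F n k | U ≤ C}.ncard : ℚ) =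
        BilinearCodes.tau (Fintype.card F) (n - 2 * t) (k - t) (w - t)) ∧
    (BilinearCodes.bilinType (BilinearCodes.stdForm F n) = BilinearCodes.BilinType.N0na →
      (1 : Fin n → F) ∉ U →
      {C ∈ BilinearCodes.selfOrthogonalCodes F n k | U ≤ C}.ncard =
        BilinearCodes.numSelfOrthogonalCodes F (n - 2 * t) (k - t)) ∧
    (BilinearCodes.bilinType (BilinearCodes.stdForm F n) = BilinearCodes.BilinType.N0na →
      (1 : Fin n → F) ∈ U →
      {C ∈ BilinearCodes.selfOrthogonalCodes F n k | U ≤ C}.ncard =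
        BilinearCodes.numSelfOrthogonalCodes F (n - 2 * t + 1) (k - t)) := by
  have hV : Module.finrank F (Fin n → F) = n := by simp
  have hs := BilinearCodes.stdForm_isSymm F n
  have hB := BilinearCodes.stdForm_nondegenerate F n
  have h2w : 2 * w ≤ n := by
    obtain ⟨W, hW, hWdim⟩ := BilinearCodes.exists_finrank_eq_wittIndex (BilinearCodes.stdForm F n)
    have := hW.two_mul_finrank_le hB
    omega
  obtain ⟨d, rfl⟩ := Nat.exists_eq_add_of_le htk
  subst hUdim
  rw [BilinearCodes.setOf_selfOrthogonalCodes_le, Nat.add_sub_cancel_left]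
  refine ⟨fun htype => ?_, fun htype h1 => ?_, fun htype h1 => ?_⟩
  · have hI : ∀ W : Submodule F (Fin n → F),
        BilinearCodes.IsSelfOrthogonal (BilinearCodes.stdForm F n) W →
        (BilinearCodes.isotropicOrthogonal (BilinearCodes.stdForm F n) W).ncard +
            Fintype.card F ^ (Module.finrank F (Fin n → F) - w - 1) =
          Fintype.card F ^ w +
            Fintype.card F ^ (Module.finrank F (Fin n → F) - Module.finrank F W - 1) := by
      intro W hW
      by_cases hq : Odd (Fintype.card F)
      · rw [hw]
        exact BilinearCodes.ncard_isotropicOrthogonal_of_two_ne_zero hs hB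
          (BilinearCodes.two_ne_zero_of_odd_card hq) hW
      · have := BilinearCodes.charP_two_of_not_odd_card hq
        have hodd : Odd n := by
          by_contra hodd
          simp only [BilinearCodes.bilinType, hq, hV, hodd, if_false] at htype
          split_ifs at htype <;> simp at htype
        have hee : BilinearCodes.stdForm F n 1 1 ≠ 0 := by
          rw [BilinearCodes.stdForm_one_one, Ne, CharP.cast_eq_zero_iff F 2,
            ← even_iff_two_dvd, Nat.not_even_iff_odd]
          exact hodd
        have he := BilinearCodes.stdForm_self_eq_zero_iff (F := F) n
        have hnw := BilinearCodes.finrank_eq_two_mul_wittIndex_add_one hs hB he hee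
          (by rwa [hV])
        rw [← hw] at hnw
        -- As n = 2w + 1, the terms q^w and q^(n-w-1) coincide, leaving I(W) = q^(n - dim W - 1).
        rw [BilinearCodes.ncard_isotropicOrthogonal_of_notMem hB he
          fun h => hee (hW.apply_eq_zero h h),
          show Module.finrank F (Fin n → F) - w - 1 = w by omega, add_comm]
    have := BilinearCodes.ncard_selfOrthogonalAbove_eq_tau hs (by omega) hI d U hU hkw
    rwa [hV] at this
  all_goals
    obtain ⟨hq, hodd⟩ : ¬ Odd (Fintype.card F) ∧ ¬ Odd n := by
      rw [BilinearCodes.bilinType, hV] at htype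
      split_ifs at htype
      constructor <;> assumption
    have := BilinearCodes.charP_two_of_not_odd_card hq
    have he := BilinearCodes.stdForm_self_eq_zero_iff (F := F)
    have hee : ∀ m, Even m → BilinearCodes.stdForm F m 1 1 = 0 := fun m hm => by
      rw [BilinearCodes.stdForm_one_one, CharP.cast_eq_zero_iff F 2, ← even_iff_two_dvd]
      exact hm
    rw [Nat.not_odd_iff_even] at hodd
    rw [BilinearCodes.numSelfOrthogonalCodes_eq, ← Nat.cast_inj (R := ℚ)]
  -- Adjoining 𝟏 to `U` keeps it self-orthogonal, so n - 2t ≥ 2; hence 𝟏 is nonzero in F^(n-2t) and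
  -- `⊥` there falls under the same case.
  · have hUn : 2 * Module.finrank F U + 2 ≤ n := by
      have hI : (1 : Fin n → F) ∈
          BilinearCodes.isotropicOrthogonal (BilinearCodes.stdForm F n) U :=
        ⟨fun u hu => by rw [hs.eq u 1, ← he]; exact hU.apply_eq_zero hu hu, hee n hodd⟩
      have := (hU.sup_span_singleton hs hI).two_mul_finrank_le hB
      rw [Submodule.finrank_sup_span_singleton h1] at this
      omega
    have key := BilinearCodes.ncard_selfOrthogonalAbove_of_notMem hs hB (he n) (hee n hodd) d U hU
      h1
    have hodd' : Even (n - 2 * Module.finrank F U) := by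
      rw [Nat.even_sub (by omega)]; simp [hodd]
    have : NeZero (n - 2 * Module.finrank F U) := ⟨by omega⟩
    have key' := BilinearCodes.ncard_selfOrthogonalAbove_of_notMem
      (BilinearCodes.stdForm_isSymm F _) (BilinearCodes.stdForm_nondegenerate F _)
      (he (n - 2 * Module.finrank F U)) (hee _ hodd') d ⊥
      (BilinearCodes.isSelfOrthogonal_bot _) (by simp)
    rw [key, hV]
    simpa using key'.symm
  · have key := BilinearCodes.ncard_selfOrthogonalAbove_of_mem hs hB (he n) hU h1 d
    have hUn := hU.two_mul_finrank_le hB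
    rw [hV] at hUn
    have hodd' : Odd (n - 2 * Module.finrank F U + 1) := by
      refine Even.add_one ?_
      rw [Nat.even_sub hUn]; simp [hodd]
    -- The extra dimension is absorbed by the `- 1` of the odd-dimensional count, giving the
    -- symplectic count in dimension n - 2t.
    have key' := BilinearCodes.ncard_selfOrthogonalAbove_of_odd
      (BilinearCodes.stdForm_isSymm F _) (BilinearCodes.stdForm_nondegenerate F _)
      (he (n - 2 * Module.finrank F U + 1))
      (by
        rw [BilinearCodes.stdForm_one_one, Ne, CharP.cast_eq_zero_iff F 2,
          ← even_iff_two_dvd, Nat.not_even_iff_odd]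
        exact hodd')
      (by simpa using hodd') (BilinearCodes.isSelfOrthogonal_bot _) d
    rw [key, hV]
    simpa using key'.symm
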